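/- Let $X\in\mathbb{R}^{n\times d}$ have rank $d$ and rows $x_1^T,\dots,x_n^T$, and let $n=mk$ with $k\ge 1$. A bagging is a partition $B=(B_1,\dots,B_m)$ of the $n$ samples into $m$ bags of size exactly $k$; its $k$-means objective on $w\in\mathbb{R}^n$ is $\sum_{l=1}^m\sum_{i\in B_l}(w_i-\mu_l)^2$, where $\mu_l$ is the mean of $w$ over $B_l$. Let $R>0$, $0<\varepsilon\le 2$, $0<\delta<1$ and $$\alpha^2=\frac{16R^2\log\left(\frac{1.25}{\delta/2}\right)}{\varepsilon^2}.$$ For a measurable rule $C$ that returns for every $w\in\mathbb{R}^n$ a bagging with minimal $k$-means objective on $w$, and for $v\ge 0$, consider the following mechanism on label vectors $y\in\mathbb{R}^n$: add independent $\mathcal N(0,\alpha^2)$ noise to each label and let $B$ be the bagging that $C$ returns for the noisy labels; then, for each bag $B_l$ independently and with fresh randomness, let the bag-label $\overline y_l$ be a uniformly random one of the labels $(y_i)_{i\in B_l}$ plus independent $\mathcal N(0,v)$ noise; release $(B,\overline y)$. There are such a $C$ and $v$, depending only on $X,n,m,k,R,\varepsilon,\delta$, with the following two properties. (1) The mechanism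 is $(\varepsilon,\delta)$-label-DP for labels bounded by $R$: for all $y,y'\in[-R,R]^n$ that differ in at most one entry and every measurable set $S$ of outputs, $\Pr[A(y)\in S]\le e^{\varepsilon}\Pr[A(y')\in S]+\delta$. (2) Let $\theta^*\in\mathbb{R}^d$, $\tilde y_i=x_i^T\theta^*$ and $y_i=\tilde y_i+\gamma_i$, where the $\gamma_i$ are independent (not necessarily identically distributed) with mean $0$ and variance $\sigma^2$ (for example $\gamma_i\sim\mathcal N(0,\sigma^2)$), and assume $\mathbb{E}[y_i^2]=\tilde y_i^2+\sigma^2\le R^2$ for all $i$ (for example because $|y_i|\le R$ almost surely). If $\hat\theta$ minimizes the instance-level loss $\frac1n\sum_{l=1}^m\sum_{i\in B_l}(\overline y_l-x_i^T\theta)^2$ over $\theta\in\mathbb{R}^d$ for the output $(B,\overline y)$ of the mechanism on $y$, then $$\mathbb{E}\|\hat\theta-\theta^*\|_2^2\le\|(X^TX)^{-1}X^T\|_{op}^2\left(2\left(OPT+n\left(1-\tfrac1k\right)\alpha^2\right)+d\left(\sigma^2+\tfrac{\alpha^2}{k^2}\right)\right),$$ where $OPT$ is the minimum over all baggings of the $k$-means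 objective on $\tilde y$, and the expectation is over the noise $\gamma$ and the randomness of the mechanism. -/

import Mathlib

open MeasureTheory ProbabilityTheory Matrix
open scoped NNReal ENNReal

noncomputable section

/-- A bagging of `n` samples into `m` labelled, pairwise disjoint bags of exactly `k` samples each:
`toFun i` is the bag that contains sample `i`. -/
@[ext]
structure Bagging (n m k : ℕ) where
  toFun : Fin n → Fin m
  card_fiber : ∀ l, (Finset.univ.filter fun i => toFun i = l).card = k

namespace Bagging

variable {n m k : ℕ}

/-- The set of samples in bag `l`. -/
def bag (B : Bagging n m k) (l : Fin m) : Finset (Fin n) :=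
  Finset.univ.filter fun i => B.toFun i = l

/-- There are finitely many baggings, so all sets of baggings are measurable. -/
instance : MeasurableSpace (Bagging n m k) := ⊤

/-- The mean of the values `w` in bag `l`. -/
def bagMean (B : Bagging n m k) (w : Fin n → ℝ) (l : Fin m) : ℝ :=
  (∑ i ∈ B.bag l, w i) / ((B.bag l).card : ℝ)

/-- The k-means objective of the bagging `B` on the values `w`. -/
def kMeansCost (B : Bagging n m k) (w : Fin n → ℝ) : ℝ :=
  ∑ l, ∑ i ∈ B.bag l, (w i - B.bagMean w l) ^ 2

end Bagging

/-- The optimal value of the k-means objective on the values `w` over all baggings of the `n`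
samples into `m` bags of size `k`. -/
def kMeansOpt {n : ℕ} (m k : ℕ) (w : Fin n → ℝ) : ℝ :=
  ⨅ B : Bagging n m k, B.kMeansCost w

/-- `C` is a (measurable) rule that returns, for all values `w`, an optimal k-means clustering of
`w` into `m` bags of size `k`. -/
def IsOptimalClustering {n m k : ℕ} (C : (Fin n → ℝ) → Bagging n m k) : Prop :=
  Measurable C ∧ ∀ (w : Fin n → ℝ) (B : Bagging n m k), (C w).kMeansCost w ≤ B.kMeansCost w

/-- The law of the noisy label vector: independent `N(0, s)` noise is added to each label. -/
def noisyLabels {n : ℕ} (s : ℝ≥0) (y : Fin n → ℝ) : Measure (Fin n → ℝ) :=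
  Measure.pi fun i => gaussianReal (y i) s

/-- The law of the bag labels of multiple instance regression for the bagging `B` and the labels
`y`: independently for each bag, a uniformly random label of the bag is chosen and an independent
`N(0, v)` noise is added to it. -/
def mirBagLabels {n m k : ℕ} (v : ℝ≥0) (y : Fin n → ℝ) (B : Bagging n m k) :
    Measure (Fin m → ℝ) :=
  Measure.pi fun l => ∑ i ∈ B.bag l, ((B.bag l).card : ℝ≥0∞)⁻¹ • gaussianReal (y i) v

/-- The private bagging mechanism, as the law of its output for the label vector `y`. It clusters
the labels after adding `N(0, s)` noise to each of them, draws the bag labels of the resulting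
bagging with `N(0, v)` noise (with fresh randomness), and releases the bagging and the bag labels. -/
def privateMIR {n m k : ℕ} (C : (Fin n → ℝ) → Bagging n m k) (s v : ℝ≥0) (y : Fin n → ℝ) :
    Measure (Bagging n m k × (Fin m → ℝ)) :=
  ((noisyLabels s y).map C).bind fun B => (mirBagLabels v y B).map fun z => (B, z)

/-- `(ε, δ)`-label differential privacy of a randomized algorithm, given by the law `A y` of its
output on the labels `y` (the feature vectors are fixed and public), for labels bounded by `R`. -/
def LabelDP {n : ℕ} {O : Type*} [MeasurableSpace O] (R ε δ : ℝ) (A : (Fin n → ℝ) → Measure O) :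
    Prop :=
  ∀ y y' : Fin n → ℝ, (∀ i, |y i| ≤ R) → (∀ i, |y' i| ≤ R) →
    (∃ i, ∀ j, j ≠ i → y j = y' j) →
    ∀ S : Set O, MeasurableSet S →
      A y S ≤ ENNReal.ofReal (Real.exp ε) * A y' S + ENNReal.ofReal δ

/-- The instance-level squared loss of the linear model `θ`: each sample of bag `l` is given the
bag label `z l`. -/
def instanceLoss {n m k d : ℕ} (X : Matrix (Fin n) (Fin d) ℝ) (B : Bagging n m k)
    (z : Fin m → ℝ) (θ : EuclideanSpace ℝ (Fin d)) : ℝ :=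
  (1 / (n : ℝ)) * ∑ l, ∑ i ∈ B.bag l, (z l - X i ⬝ᵥ θ.ofLp) ^ 2

/-- The estimator `est`, a function of the released bagging and bag labels, minimizes the
instance-level loss. -/
def MinimizesInstanceLoss {n m k d : ℕ} (X : Matrix (Fin n) (Fin d) ℝ)
    (est : Bagging n m k × (Fin m → ℝ) → EuclideanSpace ℝ (Fin d)) : Prop :=
  ∀ o, IsMinOn (instanceLoss X o.1 o.2) Set.univ (est o)

/-- The `ℓ²` operator norm of a real matrix. -/
def opNorm {p q : ℕ} (M : Matrix (Fin p) (Fin q) ℝ) : ℝ :=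
  ‖LinearMap.toContinuousLinearMap (Matrix.toLpLin 2 2 M)‖

/-- The noise level `α² = 16 R² log (1.25 / (δ / 2)) / ε²`. -/
def alphaSq (R ε δ : ℝ) : ℝ :=
  16 * R ^ 2 * Real.log (1.25 / (δ / 2)) / ε ^ 2

end

/-! The witnesses are any measurable optimal clustering rule and `v = α² - 2R²`.

Privacy: with all other randomness fixed, label `i` enters the output only through two independent
Gaussian copies of it, of variances `α²` and `v` (`lintegral_privateMIR_eq_resampled`). The output
is thus post-processing of this pair. Its privacy loss is Gaussian with mean `τ/2` and variance `τ ≤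
4R²(1/α² + 1/v)`, and a Gaussian tail bound shows that it exceeds `ε` with probability at most `δ`
(`lintegral_gaussianReal_prod_le`, `failure_probability_le`).

Utility: the error is `A = (XᵀX)⁻¹Xᵀ` applied to the vector of bag label minus true mean. For `k ≥
2` the quality of the clustering plays no role: for every bagging the expected squared deviations
are bounded by a sum over samples whose mean is at most `v + 2R² = α²` each, and `nα² ≤ 2n(1 -
1/k)α²`. For `k = 1` the bags are singletons, the deviations are centred and independent, and the
variance is governed by the `d` rows of `A`. -/

/-! ### Gaussian tails and the privacy of a pair of Gaussian releases -/

/-- Off `s` the densities compare pointwise, and `s` itself pays its full mass. A test function in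
place of an event covers randomized post-processing. -/
lemma lintegral_withDensity_le_of_le_off {α : Type*} [MeasurableSpace α] (μ : Measure α)
    {p q f : α → ℝ≥0∞} (hp : Measurable p) (hq : Measurable q) (hf : Measurable f)
    (hf1 : ∀ z, f z ≤ 1) (c : ℝ≥0∞) {s : Set α} (hs : MeasurableSet s)
    (h : ∀ z, z ∉ s → p z ≤ c * q z) :
    ∫⁻ z, f z ∂μ.withDensity p ≤ c * ∫⁻ z, f z ∂μ.withDensity q + μ.withDensity p s := by
  rw [lintegral_withDensity_eq_lintegral_mul _ hp hf, lintegral_withDensity_eq_lintegral_mul _ hq hf,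
    withDensity_apply _ hs, ← lintegral_indicator hs, ← lintegral_const_mul _ (hq.mul hf),
    ← lintegral_add_left ((hq.mul hf).const_mul c)]
  refine lintegral_mono fun z => ?_
  simp only [Pi.mul_apply]
  by_cases hz : z ∈ s
  · rw [Set.indicator_of_mem hz]
    exact le_add_left (mul_le_of_le_one_right' (hf1 z))
  · rw [Set.indicator_of_notMem hz, add_zero, ← mul_assoc]
    exact mul_le_mul_left (h z hz) _

lemma gaussianReal_Ioi_zero_le (v : ℝ≥0) : gaussianReal 0 v (Set.Ioi 0) ≤ 1 / 2 := by
  have h1 : gaussianReal 0 v (Set.Iio 0) = gaussianReal 0 v (Set.Ioi 0) := by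
    have h := gaussianReal_map_neg (μ := 0) (v := v)
    rw [neg_zero] at h
    conv_lhs => rw [← h]
    rw [Measure.map_apply measurable_neg measurableSet_Iio]
    congr 1
    ext x; simp
  have h2 : gaussianReal 0 v (Set.Iio 0 ∪ Set.Ioi 0) ≤ 1 := prob_le_one
  rw [measure_union (by
    rw [Set.disjoint_left]
    intro x hx hx'
    exact lt_asymm (Set.mem_Iio.1 hx) (Set.mem_Ioi.1 hx')) measurableSet_Ioi, h1, ← two_mul] at h2
  rw [ENNReal.le_div_iff_mul_le (by simp) (by simp), mul_comm]
  exact h2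

/-- Since `(x + t)² ≥ x² + t²` for `x, t ≥ 0`, shifting by `t` costs a factor `exp (-t²/2v)` on the
half-line. The factor `1/2` is spent in `failure_probability_le`. -/
lemma gaussianReal_Ioi_le {v : ℝ≥0} (hv : v ≠ 0) {t : ℝ} (ht : 0 ≤ t) :
    gaussianReal 0 v (Set.Ioi t) ≤ ENNReal.ofReal (1 / 2 * Real.exp (-(t ^ 2 / (2 * v)))) := by
  have h1 : gaussianReal 0 v (Set.Ioi t) = gaussianReal (-t) v (Set.Ioi 0) := by
    have h := gaussianReal_map_add_const (μ := 0) (v := v) (-t)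
    rw [zero_add] at h
    rw [← h, Measure.map_apply (by fun_prop) measurableSet_Ioi]
    congr 1
    ext x; simp
  have h2 : gaussianReal (-t) v (Set.Ioi 0) ≤
      ENNReal.ofReal (Real.exp (-(t ^ 2 / (2 * v)))) * gaussianReal 0 v (Set.Ioi 0) := by
    rw [gaussianReal_apply _ hv, gaussianReal_apply _ hv,
      ← lintegral_const_mul _ (measurable_gaussianPDF _ _)]
    refine setLIntegral_mono ((measurable_gaussianPDF _ _).const_mul _) fun x hx => ?_
    rw [gaussianPDF, gaussianPDF, ← ENNReal.ofReal_mul (by positivity)]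
    refine ENNReal.ofReal_le_ofReal ?_
    rw [gaussianPDFReal, gaussianPDFReal, mul_left_comm, ← Real.exp_add]
    refine mul_le_mul_of_nonneg_left (Real.exp_le_exp.2 ?_) (by positivity)
    have hv' : (0 : ℝ) < v := by positivity
    have hx' : (0 : ℝ) < x := hx
    rw [← neg_div, ← add_div]
    refine div_le_div_of_nonneg_right ?_ (by positivity)
    nlinarith [mul_nonneg ht hx'.le]
  rw [h1]
  refine h2.trans ((mul_le_mul_right (gaussianReal_Ioi_zero_le v) _).trans ?_)
  rw [mul_comm (1 / 2 : ℝ), ENNReal.ofReal_mul (by positivity)]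
  refine mul_le_mul_right ?_ _
  rw [ENNReal.ofReal_div_of_pos (by norm_num)]
  simp

/-- For `Δ = b - b'` this is the law of the log-likelihood ratio of the pair, centred at its mean
`Δ²(1/s + 1/v)/2`. -/
lemma map_linear_gaussianReal_prod (b Δ : ℝ) {s v : ℝ≥0} (hs : s ≠ 0) (hv : v ≠ 0) :
    ((gaussianReal b s).prod (gaussianReal b v)).map
      (fun z => (Δ / s * z.1 - Δ / s * b) + (Δ / v * z.2 - Δ / v * b)) =
      gaussianReal 0 (Real.toNNReal (Δ ^ 2 * (1 / s + 1 / v))) := by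
  have key : ∀ {w : ℝ≥0}, w ≠ 0 → (gaussianReal b w).map (fun x => Δ / w * x - Δ / w * b) =
      gaussianReal 0 (Real.toNNReal (Δ ^ 2 * (1 / w))) := by
    intro w hw
    have hw' : (w : ℝ) ≠ 0 := by exact_mod_cast hw
    have h1 := gaussianReal_map_const_mul (μ := b) (v := w) (Δ / w)
    have h2 := gaussianReal_map_sub_const (μ := Δ / w * b) (v := NNReal.mk ((Δ / w) ^ 2) (sq_nonneg _) * w)
      (Δ / w * b)
    rw [sub_self, ← h1, Measure.map_map (by fun_prop) (by fun_prop)] at h2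
    rw [show (fun x : ℝ => Δ / w * x - Δ / w * b) =
      (fun x => x - Δ / w * b) ∘ (fun x => Δ / w * x) from rfl, h2]
    congr 1
    ext
    rw [Real.coe_toNNReal _ (by positivity)]
    push_cast
    field_simp
  have h := gaussianReal_conv_gaussianReal (m₁ := 0) (m₂ := 0)
    (v₁ := Real.toNNReal (Δ ^ 2 * (1 / s))) (v₂ := Real.toNNReal (Δ ^ 2 * (1 / v)))
  rw [← key hs, ← key hv, Measure.conv, Measure.map_prod_map _ _ (by fun_prop) (by fun_prop),
    Measure.map_map (by fun_prop) (by fun_prop), add_zero,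
    ← Real.toNNReal_add (by positivity) (by positivity), ← mul_add] at h
  exact h

lemma gaussianPDF_mul_le {b b' : ℝ} {s v : ℝ≥0} (hs : s ≠ 0) (hv : v ≠ 0) {ε : ℝ} (z : ℝ × ℝ)
    (hz : ((b - b') / s * z.1 - (b - b') / s * b) + ((b - b') / v * z.2 - (b - b') / v * b) ≤
      ε - (b - b') ^ 2 * (1 / s + 1 / v) / 2) :
    gaussianPDF b s z.1 * gaussianPDF b v z.2 ≤
      ENNReal.ofReal (Real.exp ε) * (gaussianPDF b' s z.1 * gaussianPDF b' v z.2) := by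
  have hs' : (s : ℝ) ≠ 0 := by exact_mod_cast hs
  have hv' : (v : ℝ) ≠ 0 := by exact_mod_cast hv
  simp only [gaussianPDF]
  rw [← ENNReal.ofReal_mul (gaussianPDFReal_nonneg _ _ _),
    ← ENNReal.ofReal_mul (gaussianPDFReal_nonneg _ _ _), ← ENNReal.ofReal_mul (by positivity)]
  refine ENNReal.ofReal_le_ofReal ?_
  simp only [gaussianPDFReal]
  have key : ∀ A B x y : ℝ, A * Real.exp x * (B * Real.exp y) = A * B * Real.exp (x + y) := by
    intro A B x y
    rw [Real.exp_add]
    ring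
  rw [key, key, mul_left_comm (Real.exp ε), ← Real.exp_add]
  refine mul_le_mul_of_nonneg_left (Real.exp_le_exp.2 ?_) (by positivity)
  have e : -(z.1 - b) ^ 2 / (2 * s) + -(z.2 - b) ^ 2 / (2 * v) -
      (-(z.1 - b') ^ 2 / (2 * s) + -(z.2 - b') ^ 2 / (2 * v)) =
      ((b - b') / s * z.1 - (b - b') / s * b) + ((b - b') / v * z.2 - (b - b') / v * b) +
      (b - b') ^ 2 * (1 / s + 1 / v) / 2 := by
    field_simp
    ring
  linarith

/-- The joint release of two Gaussian perturbations of the same bounded number is differentially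
private. -/
lemma lintegral_gaussianReal_prod_le {b b' R ε δ : ℝ} {s v : ℝ≥0} (hs : s ≠ 0) (hv : v ≠ 0)
    (hε : 0 < ε) (hb : |b| ≤ R) (hb' : |b'| ≤ R)
    (hM : 4 * R ^ 2 * (1 / s + 1 / v) ≤ 2 * ε)
    (hδ : 1 / 2 * Real.exp (ε / 2 - ε ^ 2 / (2 * (4 * R ^ 2 * (1 / s + 1 / v)))) ≤ δ)
    {f : ℝ × ℝ → ℝ≥0∞} (hf : Measurable f) (hf1 : ∀ z, f z ≤ 1) :
    ∫⁻ z, f z ∂(gaussianReal b s).prod (gaussianReal b v) ≤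
      ENNReal.ofReal (Real.exp ε) * ∫⁻ z, f z ∂(gaussianReal b' s).prod (gaussianReal b' v) +
        ENNReal.ofReal δ := by
  -- For equal labels the privacy loss has variance zero, which the tail bound excludes.
  rcases eq_or_ne b b' with rfl | hne
  · refine le_add_right (le_mul_of_one_le_left' ?_)
    rw [ENNReal.one_le_ofReal]
    exact Real.one_le_exp hε.le
  have hs' : (0 : ℝ) < s := by positivity
  have hv' : (0 : ℝ) < v := by positivity
  set τ : ℝ := (b - b') ^ 2 * (1 / s + 1 / v) with hτ
  have hΔ : 0 < (b - b') ^ 2 := by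
    have := sub_ne_zero.2 hne
    positivity
  have hτ0 : 0 < τ := by positivity
  have hΔR : (b - b') ^ 2 ≤ 4 * R ^ 2 := by
    rw [abs_le] at hb hb'
    nlinarith
  have hτM : τ ≤ 4 * R ^ 2 * (1 / s + 1 / v) :=
    mul_le_mul_of_nonneg_right hΔR (by positivity)
  set M : ℝ := 4 * R ^ 2 * (1 / s + 1 / v)
  let g : ℝ × ℝ → ℝ := fun z =>
    ((b - b') / s * z.1 - (b - b') / s * b) + ((b - b') / v * z.2 - (b - b') / v * b)
  have hg : Measurable g := by fun_prop
  have hS : MeasurableSet (g ⁻¹' Set.Ioi (ε - τ / 2)) := hg measurableSet_Ioi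
  have hbad : ((gaussianReal b s).prod (gaussianReal b v)) (g ⁻¹' Set.Ioi (ε - τ / 2)) ≤
      ENNReal.ofReal δ := by
    rw [← Measure.map_apply hg measurableSet_Ioi, map_linear_gaussianReal_prod b (b - b') hs hv,
      ← hτ]
    refine (gaussianReal_Ioi_le (by simpa using hτ0) (by linarith)).trans
      (ENNReal.ofReal_le_ofReal (le_trans ?_ hδ))
    rw [Real.coe_toNNReal _ hτ0.le]
    refine mul_le_mul_of_nonneg_left (Real.exp_le_exp.2 ?_) (by norm_num)
    -- Dropping `τ/8` leaves an expression monotone in `τ`, so `τ` can be replaced by its upper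
    -- bound `M`.
    have h1 : (ε - τ / 2) ^ 2 / (2 * τ) = ε ^ 2 / (2 * τ) - ε / 2 + τ / 8 := by
      field_simp
      ring
    have h2 : ε ^ 2 / (2 * M) ≤ ε ^ 2 / (2 * τ) := by
      apply div_le_div_of_nonneg_left <;> nlinarith
    linarith
  refine le_trans ?_ (add_le_add_right hbad _)
  simp only [gaussianReal_of_var_ne_zero _ hs, gaussianReal_of_var_ne_zero _ hv]
  rw [prod_withDensity (measurable_gaussianPDF _ _) (measurable_gaussianPDF _ _),
    prod_withDensity (measurable_gaussianPDF _ _) (measurable_gaussianPDF _ _)]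
  have hm : ∀ c, Measurable fun z : ℝ × ℝ => gaussianPDF c s z.1 * gaussianPDF c v z.2 := fun c =>
    ((measurable_gaussianPDF _ _).comp measurable_fst).mul
      ((measurable_gaussianPDF _ _).comp measurable_snd)
  refine lintegral_withDensity_le_of_le_off _ (hm b) (hm b') hf hf1 _ hS fun z hz => ?_
  exact gaussianPDF_mul_le hs hv z (not_lt.1 hz)

/-! ### Numerical constants of the privacy bound -/

lemma seven_eighths_le_log {δ : ℝ} (hδ : 0 < δ) (hδ1 : δ < 1) :
    7 / 8 ≤ Real.log (1.25 / (δ / 2)) := by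
  rw [Real.le_log_iff_exp_le (by positivity)]
  -- Eighth powers reduce this to `e⁷ ≤ 2.5⁸`.
  have h1 : Real.exp (7 / 8) ≤ 2.5 := by
    refine le_of_pow_le_pow_left₀ (n := 8) (by norm_num) (by norm_num) ?_
    rw [← Real.exp_nat_mul]
    have h2 : Real.exp ((8 : ℕ) * (7 / 8)) = Real.exp 1 ^ 7 := by
      rw [← Real.exp_nat_mul]; norm_num
    rw [h2]
    exact (pow_le_pow_left₀ (Real.exp_pos 1).le Real.exp_one_lt_d9.le 7).trans (by norm_num)
  refine h1.trans ?_
  rw [le_div_iff₀ (by positivity)]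
  linarith

lemma four_mul_sq_mul_log_le_alphaSq {R ε δ : ℝ} (hε : 0 < ε) (hε2 : ε ≤ 2) (hδ : 0 < δ)
    (hδ1 : δ < 1) : 4 * R ^ 2 * Real.log (1.25 / (δ / 2)) ≤ alphaSq R ε δ := by
  have hL := seven_eighths_le_log hδ hδ1
  rw [alphaSq, le_div_iff₀ (by positivity)]
  have : ε ^ 2 ≤ 4 := by nlinarith
  have h0 : 0 ≤ 4 * R ^ 2 * Real.log (1.25 / (δ / 2)) := by positivity
  nlinarith

lemma alphaSq_ge {R ε δ : ℝ} (hε : 0 < ε) (hε2 : ε ≤ 2) (hδ : 0 < δ) (hδ1 : δ < 1) :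
    7 / 2 * R ^ 2 ≤ alphaSq R ε δ := by
  have hL := seven_eighths_le_log hδ hδ1
  have := four_mul_sq_mul_log_le_alphaSq (R := R) hε hε2 hδ hδ1
  nlinarith [sq_nonneg R]

/-- This keeps the threshold `ε - τ/2` nonnegative, as the tail bound requires. -/
lemma sensitivity_le {R ε δ : ℝ} (hR : 0 < R) (hε : 0 < ε) (hε2 : ε ≤ 2) (hδ : 0 < δ)
    (hδ1 : δ < 1) :
    4 * R ^ 2 * (1 / alphaSq R ε δ + 1 / (alphaSq R ε δ - 2 * R ^ 2)) ≤ 2 * ε := by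
  have hL := seven_eighths_le_log hδ hδ1
  have ha := alphaSq_ge (R := R) hε hε2 hδ hδ1
  have hae : 7 * R ^ 2 ≤ ε * alphaSq R ε δ := by
    have : ε * alphaSq R ε δ = 16 * R ^ 2 * Real.log (1.25 / (δ / 2)) / ε := by
      rw [alphaSq]; field_simp
    rw [this, le_div_iff₀ hε]
    nlinarith [sq_nonneg R, mul_nonneg (sq_nonneg R) (sub_nonneg.2 hε2),
      mul_nonneg (sq_nonneg R) (sub_nonneg.2 hL)]
  set a := alphaSq R ε δ
  have hR2 : 0 < R ^ 2 := by positivity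
  have h1 : 0 < a := by nlinarith
  have h2 : 0 < a - 2 * R ^ 2 := by nlinarith
  rw [div_add_div _ _ h1.ne' h2.ne', ← mul_div_assoc, div_le_iff₀ (by positivity)]
  nlinarith [mul_le_mul_of_nonneg_right hae h2.le, mul_nonneg hR2.le (sub_nonneg.2 ha)]

lemma failure_probability_le {R ε δ : ℝ} (hR : 0 < R) (hε : 0 < ε) (hε2 : ε ≤ 2) (hδ : 0 < δ)
    (hδ1 : δ < 1) :
    1 / 2 * Real.exp (ε / 2 - ε ^ 2 /
      (2 * (4 * R ^ 2 * (1 / alphaSq R ε δ + 1 / (alphaSq R ε δ - 2 * R ^ 2))))) ≤ δ := by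
  have hL := seven_eighths_le_log hδ hδ1
  have haL := four_mul_sq_mul_log_le_alphaSq (R := R) hε hε2 hδ hδ1
  have ha := alphaSq_ge (R := R) hε hε2 hδ hδ1
  have he : ε ^ 2 * alphaSq R ε δ = 16 * R ^ 2 * Real.log (1.25 / (δ / 2)) := by
    rw [alphaSq]; field_simp
  have hexp : Real.exp (-Real.log (1.25 / (δ / 2))) = δ / 2.5 := by
    rw [Real.exp_neg, Real.exp_log (by positivity), inv_div]
    ring
  set a := alphaSq R ε δ
  set L := Real.log (1.25 / (δ / 2))
  have hR2 : 0 < R ^ 2 := by positivity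
  have h1 : 0 < a := by nlinarith
  have h2 : 0 < a - 2 * R ^ 2 := by nlinarith
  have h3 : 0 < a - R ^ 2 := by nlinarith
  -- The main term `L` produces `δ / 2.5`; the correction is the price of lowering the second
  -- variance by `2R²`.
  have h4 : ε ^ 2 / (2 * (4 * R ^ 2 * (1 / a + 1 / (a - 2 * R ^ 2)))) =
      L - L * R ^ 2 / (a - R ^ 2) := by
    have h5 : 2 * (4 * R ^ 2 * (1 / a + 1 / (a - 2 * R ^ 2))) =
        16 * R ^ 2 * (a - R ^ 2) / (a * (a - 2 * R ^ 2)) := by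
      field_simp
      ring
    rw [h5, div_div_eq_mul_div, ← mul_assoc, he]
    field_simp
    ring
  -- From `a ≥ 4R²L` the quotient is at most `L / (4L - 1)`, which is below `3/8` once `L ≥ 3/4`.
  have h6 : L * R ^ 2 / (a - R ^ 2) ≤ 3 / 8 := by
    rw [div_le_iff₀ h3]
    nlinarith
  rw [h4]
  -- Here `11/8` is `1` from `ε ≤ 2` plus `3/8` from the correction.
  have h7 : ε / 2 - (L - L * R ^ 2 / (a - R ^ 2)) ≤ 11 / 8 + -L := by linarith
  have h8 : Real.exp (11 / 8) ≤ 5 := by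
    refine le_of_pow_le_pow_left₀ (n := 8) (by norm_num) (by norm_num) ?_
    rw [← Real.exp_nat_mul]
    have h9 : Real.exp ((8 : ℕ) * (11 / 8)) = Real.exp 1 ^ 11 := by
      rw [← Real.exp_nat_mul]; norm_num
    rw [h9]
    exact (pow_le_pow_left₀ (Real.exp_pos 1).le Real.exp_one_lt_d9.le 11).trans (by norm_num)
  calc 1 / 2 * Real.exp (ε / 2 - (L - L * R ^ 2 / (a - R ^ 2)))
      ≤ 1 / 2 * Real.exp (11 / 8 + -L) :=
        mul_le_mul_of_nonneg_left (Real.exp_le_exp.2 h7) (by norm_num)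
    _ = 1 / 2 * (Real.exp (11 / 8) * (δ / 2.5)) := by rw [Real.exp_add, hexp]
    _ ≤ 1 / 2 * (5 * (δ / 2.5)) := by gcongr
    _ = δ := by ring

/-! ### Baggings and a measurable optimal clustering -/

namespace Bagging

variable {n m k : ℕ}

lemma mem_bag (B : Bagging n m k) {i : Fin n} {l : Fin m} : i ∈ B.bag l ↔ B.toFun i = l := by
  simp [bag]

lemma card_bag (B : Bagging n m k) (l : Fin m) : (B.bag l).card = k := B.card_fiber l

lemma sum_bag (B : Bagging n m k) {M : Type*} [AddCommMonoid M] (f : Fin n → M) :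
    ∑ l, ∑ i ∈ B.bag l, f i = ∑ i, f i :=
  Finset.sum_fiberwise _ _ _

lemma sum_bag_apply (B : Bagging n m k) {M : Type*} [AddCommMonoid M] (f : Fin m → Fin n → M) :
    ∑ l, ∑ i ∈ B.bag l, f l i = ∑ i, f (B.toFun i) i := by
  rw [← B.sum_bag]
  refine Finset.sum_congr rfl fun l _ => Finset.sum_congr rfl fun i hi => ?_
  rw [B.mem_bag.1 hi]

instance : Finite (Bagging n m k) :=
  Finite.of_injective Bagging.toFun fun _ _ h => Bagging.ext h

instance : MeasurableSingletonClass (Bagging n m k) := ⟨fun _ => trivial⟩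

lemma nonempty_of_eq_mul (hn : n = m * k) : Nonempty (Bagging n m k) := by
  subst hn
  refine ⟨⟨fun i => (finProdFinEquiv.symm i).1, fun l => ?_⟩⟩
  rw [← Fintype.card_subtype]
  refine (Fintype.card_congr ?_).trans (Fintype.card_fin k)
  refine
    { toFun := fun i => (finProdFinEquiv.symm i.1).2
      invFun := fun j => ⟨finProdFinEquiv (l, j), by simp⟩
      left_inv := ?_
      right_inv := fun j => by simp }
  rintro ⟨i, rfl⟩
  exact Subtype.ext (finProdFinEquiv.apply_symm_apply i)

lemma measurable_kMeansCost (B : Bagging n m k) : Measurable B.kMeansCost := by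
  unfold kMeansCost bagMean
  fun_prop

lemma kMeansCost_nonneg (B : Bagging n m k) (w : Fin n → ℝ) : 0 ≤ B.kMeansCost w :=
  Finset.sum_nonneg fun _ _ => Finset.sum_nonneg fun _ _ => sq_nonneg _

end Bagging

lemma exists_isOptimalClustering {n m k : ℕ} (hn : n = m * k) :
    ∃ C : (Fin n → ℝ) → Bagging n m k, IsOptimalClustering C := by
  classical
  have := Bagging.nonempty_of_eq_mul hn
  obtain ⟨u, hu⟩ := exists_surjective_nat (Bagging n m k)
  have hex : ∀ w : Fin n → ℝ, ∃ j, ∀ B : Bagging n m k, (u j).kMeansCost w ≤ B.kMeansCost w := by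
    intro w
    obtain ⟨B₀, hB₀⟩ := Finite.exists_min fun B : Bagging n m k => B.kMeansCost w
    obtain ⟨j, rfl⟩ := hu B₀
    exact ⟨j, hB₀⟩
  -- Ties are broken by the least index in a fixed enumeration, which makes the minimizer
  -- measurable.
  refine ⟨fun w => u (Nat.find (hex w)), ?_, fun w => Nat.find_spec (hex w)⟩
  refine (measurable_from_top (f := u)).comp (measurable_find hex fun j => ?_)
  rw [Set.ofPred_forall]
  exact MeasurableSet.iInter fun B =>
    measurableSet_le (u j).measurable_kMeansCost B.measurable_kMeansCost

lemma kMeansOpt_nonneg {n : ℕ} (m k : ℕ) (w : Fin n → ℝ) : 0 ≤ kMeansOpt m k w :=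
  Real.iInf_nonneg fun B => B.kMeansCost_nonneg w

/-! ### Resampling one coordinate of a product measure -/

lemma measurable_update_pair {ι : Type*} [DecidableEq ι] {E : ι → Type*}
    [∀ j, MeasurableSpace (E j)] (i : ι) :
    Measurable fun p : E i × (∀ j, E j) => Function.update p.2 i p.1 :=
  measurable_pi_lambda _ fun j => by
    rcases eq_or_ne j i with rfl | hj
    · simpa using measurable_fst
    · simp only [Function.update_of_ne hj]
      fun_prop

/-- A coordinate of a product measure can be resampled. -/
lemma pi_eq_map_update {ι : Type*} [Fintype ι] [DecidableEq ι] {E : ι → Type*}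
    [∀ j, MeasurableSpace (E j)] (μ μ' : ∀ j, Measure (E j)) [∀ j, IsProbabilityMeasure (μ j)]
    [∀ j, IsProbabilityMeasure (μ' j)] (i : ι) (h : ∀ j, j ≠ i → μ' j = μ j) :
    Measure.pi μ' = ((μ' i).prod (Measure.pi μ)).map fun p => Function.update p.2 i p.1 := by
  refine Measure.pi_eq fun s hs => ?_
  rw [Measure.map_apply (measurable_update_pair i) (MeasurableSet.univ_pi hs)]
  have hpre : (fun p : E i × (∀ j, E j) => Function.update p.2 i p.1) ⁻¹' Set.univ.pi s =
      s i ×ˢ Set.univ.pi (Function.update s i Set.univ) := by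
    ext p
    simp only [Set.mem_preimage, Set.mem_univ_pi, Set.mem_prod]
    constructor
    · intro hp
      refine ⟨by simpa using hp i, fun j => ?_⟩
      rcases eq_or_ne j i with rfl | hj
      · simp
      · simpa [hj] using hp j
    · rintro ⟨h1, h2⟩ j
      rcases eq_or_ne j i with rfl | hj
      · simpa using h1
      · simpa [hj] using h2 j
  rw [hpre, Measure.prod_prod, Measure.pi_pi, ← Finset.mul_prod_erase _ _ (Finset.mem_univ i),
    ← Finset.mul_prod_erase _ (fun j => μ' j (s j)) (Finset.mem_univ i)]
  simp only [Function.update_self, measure_univ, one_mul]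
  congr 1
  refine Finset.prod_congr rfl fun j hj => ?_
  rw [Function.update_of_ne (Finset.ne_of_mem_erase hj), h j (Finset.ne_of_mem_erase hj)]

lemma lintegral_pi_eq_update {ι : Type*} [Fintype ι] [DecidableEq ι] (μ μ' : ι → Measure ℝ)
    [∀ j, IsProbabilityMeasure (μ j)] [∀ j, IsProbabilityMeasure (μ' j)] (i : ι)
    (h : ∀ j, j ≠ i → μ' j = μ j) {f : (ι → ℝ) → ℝ≥0∞} (hf : Measurable f) :
    ∫⁻ z, f z ∂Measure.pi μ' = ∫⁻ p, f (Function.update p.2 i p.1) ∂(μ' i).prod (Measure.pi μ) := by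
  rw [pi_eq_map_update μ μ' i h, lintegral_map hf (measurable_update_pair i)]

/-! ### Privacy of the mechanism -/

section Mechanism

variable {n m k : ℕ}

/-- The law of a single bag label. -/
noncomputable def bagLabelLaw (v : ℝ≥0) (y : Fin n → ℝ) (B : Bagging n m k) (l : Fin m) :
    Measure ℝ :=
  ∑ i ∈ B.bag l, ((B.bag l).card : ℝ≥0∞)⁻¹ • gaussianReal (y i) v

lemma mirBagLabels_eq_pi (v : ℝ≥0) (y : Fin n → ℝ) (B : Bagging n m k) :
    mirBagLabels v y B = Measure.pi (bagLabelLaw v y B) := rfl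

lemma isProbabilityMeasure_bagLabelLaw (hk : 1 ≤ k) (v : ℝ≥0) (y : Fin n → ℝ)
    (B : Bagging n m k) (l : Fin m) : IsProbabilityMeasure (bagLabelLaw v y B l) := by
  constructor
  have hk0 : (k : ℝ≥0∞) ≠ 0 := by simp; omega
  simp [bagLabelLaw, Measure.finsetSum_apply, B.card_bag, ENNReal.mul_inv_cancel hk0]

lemma lintegral_bagLabelLaw (v : ℝ≥0) (y : Fin n → ℝ) (B : Bagging n m k) (l : Fin m)
    (f : ℝ → ℝ≥0∞) :
    ∫⁻ x, f x ∂bagLabelLaw v y B l =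
      ∑ i ∈ B.bag l, (k : ℝ≥0∞)⁻¹ * ∫⁻ x, f x ∂gaussianReal (y i) v := by
  simp [bagLabelLaw, lintegral_finsetSum_measure, B.card_bag]

lemma lintegral_privateMIR {C : (Fin n → ℝ) → Bagging n m k} (hC : Measurable C)
    (s v : ℝ≥0) (y : Fin n → ℝ) {f : Bagging n m k × (Fin m → ℝ) → ℝ≥0∞} (hf : Measurable f) :
    ∫⁻ o, f o ∂privateMIR C s v y =
      ∫⁻ w, ∫⁻ z, f (C w, z) ∂mirBagLabels v y (C w) ∂noisyLabels s y := by
  have hm : Measurable fun B : Bagging n m k => (mirBagLabels v y B).map fun z => (B, z) :=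
    measurable_from_top
  rw [privateMIR, Measure.lintegral_bind hm.aemeasurable hf.aemeasurable,
    lintegral_map measurable_from_top hC]
  refine lintegral_congr fun w => ?_
  rw [lintegral_map hf (by fun_prop)]

/-- The conditional expectation of `f` given the bagging and the noisy copy `x` of label `i` used
in the choice of the bag label. -/
noncomputable def resampled (v : ℝ≥0) (y : Fin n → ℝ) (i : Fin n)
    (f : Bagging n m k × (Fin m → ℝ) → ℝ≥0∞) (B : Bagging n m k) (x : ℝ) : ℝ≥0∞ :=
  ∑ j ∈ B.bag (B.toFun i), (k : ℝ≥0∞)⁻¹ *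
    (if j = i then ∫⁻ z, f (B, Function.update z (B.toFun i) x) ∂mirBagLabels v y B
      else ∫⁻ x', ∫⁻ z, f (B, Function.update z (B.toFun i) x') ∂mirBagLabels v y B
        ∂gaussianReal (y j) v)

lemma measurable_lintegral_update (hk : 1 ≤ k) (v : ℝ≥0) (y : Fin n → ℝ) (B : Bagging n m k)
    (l : Fin m) {f : Bagging n m k × (Fin m → ℝ) → ℝ≥0∞} (hf : Measurable f) :
    Measurable fun x => ∫⁻ z, f (B, Function.update z l x) ∂mirBagLabels v y B := by
  have := isProbabilityMeasure_bagLabelLaw hk v y B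
  rw [mirBagLabels_eq_pi]
  exact Measurable.lintegral_prod_right'
    (f := fun p : ℝ × (Fin m → ℝ) => f (B, Function.update p.2 l p.1))
    (hf.comp (measurable_const.prodMk (measurable_update_pair l)))

lemma measurable_resampled (hk : 1 ≤ k) (v : ℝ≥0) (y : Fin n → ℝ) (i : Fin n)
    {f : Bagging n m k × (Fin m → ℝ) → ℝ≥0∞} (hf : Measurable f) (B : Bagging n m k) :
    Measurable (resampled v y i f B) := by
  unfold resampled
  refine Finset.measurable_sum _ fun j _ => Measurable.const_mul ?_ _
  split_ifs
  · exact measurable_lintegral_update hk v y B _ hf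
  · exact measurable_const

lemma measurable_resampled_comp (hk : 1 ≤ k) (v : ℝ≥0) (y : Fin n → ℝ) (i : Fin n)
    {f : Bagging n m k × (Fin m → ℝ) → ℝ≥0∞} (hf : Measurable f) {Ω : Type*} [MeasurableSpace Ω]
    {g : Ω → Bagging n m k} {x : Ω → ℝ} (hg : Measurable g) (hx : Measurable x) :
    Measurable fun q => resampled v y i f (g q) (x q) := by
  have h : Measurable fun q : Bagging n m k × ℝ => resampled v y i f q.1 q.2 :=
    measurable_from_prod_countable_right fun B => measurable_resampled hk v y i hf B
  have h' := h.comp (hg.prodMk hx)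
  exact h'

lemma resampled_le_one (hk : 1 ≤ k) (v : ℝ≥0) (y : Fin n → ℝ) (i : Fin n)
    {f : Bagging n m k × (Fin m → ℝ) → ℝ≥0∞} (hf1 : ∀ o, f o ≤ 1) (B : Bagging n m k) (x : ℝ) :
    resampled v y i f B x ≤ 1 := by
  have := isProbabilityMeasure_bagLabelLaw hk v y B
  have hle : ∀ x, ∫⁻ z, f (B, Function.update z (B.toFun i) x) ∂mirBagLabels v y B ≤ 1 := by
    intro x
    rw [mirBagLabels_eq_pi]
    exact (lintegral_mono fun z => hf1 _).trans (by simp)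
  have hk0 : (k : ℝ≥0∞) ≠ 0 := by simp; omega
  calc resampled v y i f B x ≤ ∑ j ∈ B.bag (B.toFun i), (k : ℝ≥0∞)⁻¹ * 1 := by
        refine Finset.sum_le_sum fun j _ => mul_le_mul_right ?_ _
        split_ifs
        · exact hle x
        · exact (lintegral_mono hle).trans (by simp)
    _ = 1 := by simp [B.card_bag, ENNReal.mul_inv_cancel hk0]

/-- Label `i` affects only the coordinate of its own bag, which `resampled` overwrites. The
integrand is therefore the same for both label vectors, and only the law of `x` sees `y' i`. -/
lemma lintegral_mirBagLabels_eq_resampled (hk : 1 ≤ k) (v : ℝ≥0) {y y' : Fin n → ℝ} {i : Fin n}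
    (h : ∀ j, j ≠ i → y' j = y j) {f : Bagging n m k × (Fin m → ℝ) → ℝ≥0∞} (hf : Measurable f)
    (B : Bagging n m k) :
    ∫⁻ z, f (B, z) ∂mirBagLabels v y' B = ∫⁻ x, resampled v y i f B x ∂gaussianReal (y' i) v := by
  have h1 := isProbabilityMeasure_bagLabelLaw hk v y B
  have h2 := isProbabilityMeasure_bagLabelLaw hk v y' B
  have hoff : ∀ l, l ≠ B.toFun i → bagLabelLaw v y' B l = bagLabelLaw v y B l := by
    intro l hl
    refine Finset.sum_congr rfl fun j hj => ?_
    rw [h j]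
    rintro rfl
    exact hl (B.mem_bag.1 hj).symm
  have hH := measurable_lintegral_update hk v y B (B.toFun i) hf
  have hfB : Measurable fun z => f (B, z) := hf.comp measurable_prodMk_left
  rw [mirBagLabels_eq_pi, lintegral_pi_eq_update _ _ (B.toFun i) hoff hfB,
    lintegral_prod (fun p : ℝ × (Fin m → ℝ) => f (B, Function.update p.2 (B.toFun i) p.1))
      (hfB.comp (measurable_update_pair _)).aemeasurable, lintegral_bagLabelLaw]
  unfold resampled
  rw [lintegral_finsetSum]
  · refine Finset.sum_congr rfl fun j _ => ?_
    rcases eq_or_ne j i with rfl | hj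
    · simp only [if_true]
      rw [lintegral_const_mul _ hH]
      rfl
    · simp only [hj, if_false]
      rw [lintegral_const, measure_univ, mul_one, h j hj]
      rfl
  · intro j _
    refine Measurable.const_mul ?_ _
    split_ifs
    · exact hH
    · exact measurable_const

/-- The noisy label used for clustering is resampled as well, so neighbouring inputs differ only in
the inner law of the Gaussian pair. -/
lemma lintegral_privateMIR_eq_resampled (hk : 1 ≤ k) {C : (Fin n → ℝ) → Bagging n m k}
    (hC : Measurable C) (s v : ℝ≥0) {y y' : Fin n → ℝ} {i : Fin n} (h : ∀ j, j ≠ i → y' j = y j)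
    {f : Bagging n m k × (Fin m → ℝ) → ℝ≥0∞} (hf : Measurable f) :
    ∫⁻ o, f o ∂privateMIR C s v y' =
      ∫⁻ w, ∫⁻ p, resampled v y i f (C (Function.update w i p.1)) p.2
        ∂(gaussianReal (y' i) s).prod (gaussianReal (y' i) v) ∂noisyLabels s y := by
  rw [lintegral_privateMIR hC s v y' hf]
  simp_rw [lintegral_mirBagLabels_eq_resampled hk v h hf]
  have hmeas : Measurable fun w =>
      ∫⁻ x, resampled v y i f (C w) x ∂gaussianReal (y' i) v :=
    Measurable.lintegral_prod_right'
      (f := fun q : (Fin n → ℝ) × ℝ => resampled v y i f (C q.1) q.2)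
      (measurable_resampled_comp hk v y i hf (hC.comp measurable_fst) measurable_snd)
  rw [noisyLabels, lintegral_pi_eq_update (fun j => gaussianReal (y j) s) _ i
    (fun j hj => by rw [h j hj]) hmeas,
    lintegral_prod_symm (fun p : ℝ × (Fin n → ℝ) =>
      ∫⁻ x, resampled v y i f (C (Function.update p.2 i p.1)) x ∂gaussianReal (y' i) v)
      (hmeas.comp (measurable_update_pair _)).aemeasurable]
  refine lintegral_congr fun w => ?_
  rw [lintegral_prod]
  refine (measurable_resampled_comp hk v y i hf (hC.comp ?_) measurable_snd).aemeasurable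
  exact (measurable_update_pair i).comp (measurable_fst.prodMk measurable_const)

lemma labelDP_privateMIR (hk : 1 ≤ k) {C : (Fin n → ℝ) → Bagging n m k} (hC : Measurable C)
    {R ε δ : ℝ} {s v : ℝ≥0} (hs : s ≠ 0) (hv : v ≠ 0) (hε : 0 < ε)
    (hM : 4 * R ^ 2 * (1 / s + 1 / v) ≤ 2 * ε)
    (hδ : 1 / 2 * Real.exp (ε / 2 - ε ^ 2 / (2 * (4 * R ^ 2 * (1 / s + 1 / v)))) ≤ δ) :
    LabelDP R ε δ (privateMIR C s v) := by
  rintro y y' hy hy' ⟨i, hi⟩ S hS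
  have hf : Measurable (S.indicator (1 : Bagging n m k × (Fin m → ℝ) → ℝ≥0∞)) :=
    measurable_one.indicator hS
  have hf1 : ∀ o, S.indicator (1 : Bagging n m k × (Fin m → ℝ) → ℝ≥0∞) o ≤ 1 :=
    fun o => Set.indicator_le_self' (fun _ _ => zero_le) o
  rw [← lintegral_indicator_one hS, ← lintegral_indicator_one hS,
    lintegral_privateMIR_eq_resampled hk hC s v (y := y) (i := i) (fun _ _ => rfl) hf,
    lintegral_privateMIR_eq_resampled hk hC s v (y := y) (i := i) (fun j hj => (hi j hj).symm) hf]
  have hpt : ∀ w : Fin n → ℝ, Measurable fun p : ℝ × ℝ =>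
      resampled v y i (S.indicator 1) (C (Function.update w i p.1)) p.2 := fun w =>
    measurable_resampled_comp hk v y i hf
      (hC.comp ((measurable_update_pair i).comp (measurable_fst.prodMk measurable_const)))
      measurable_snd
  have hprob : IsProbabilityMeasure (noisyLabels s y) := by
    unfold noisyLabels
    infer_instance
  refine (lintegral_mono fun w => lintegral_gaussianReal_prod_le hs hv hε (hy i) (hy' i) hM hδ
    (hpt w) fun p => resampled_le_one hk v y i hf1 _ _).trans ?_
  rw [lintegral_add_right _ measurable_const, lintegral_const, measure_univ, mul_one,
    lintegral_const_mul' _ _ ENNReal.ofReal_ne_top]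

end Mechanism

/-! ### Least squares and the operator norm -/

section LeastSquares

variable {n d : ℕ}

lemma sum_sq_mulVec_le {p q : ℕ} (A : Matrix (Fin p) (Fin q) ℝ) (u : Fin q → ℝ) :
    ∑ a, (A *ᵥ u) a ^ 2 ≤ opNorm A ^ 2 * ∑ i, u i ^ 2 := by
  have h := (LinearMap.toContinuousLinearMap (Matrix.toLpLin 2 2 A)).le_opNorm (WithLp.toLp 2 u)
  have h2 := pow_le_pow_left₀ (norm_nonneg _) h 2
  rw [mul_pow, EuclideanSpace.real_norm_sq_eq, EuclideanSpace.real_norm_sq_eq] at h2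
  simpa [opNorm] using h2

lemma sum_sq_row_le {p q : ℕ} (A : Matrix (Fin p) (Fin q) ℝ) (a : Fin p) :
    ∑ i, A a i ^ 2 ≤ opNorm A ^ 2 := by
  have h1 : (A *ᵥ A a) a = ∑ i, A a i ^ 2 := by
    simp [Matrix.mulVec, dotProduct, sq]
  have h2 : (∑ i, A a i ^ 2) ^ 2 ≤ opNorm A ^ 2 * ∑ i, A a i ^ 2 := by
    rw [← h1]
    refine le_trans ?_ ((sum_sq_mulVec_le A (A a)).trans_eq (by rw [h1]))
    exact Finset.single_le_sum (f := fun a' => (A *ᵥ A a) a' ^ 2) (fun _ _ => sq_nonneg _)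
      (Finset.mem_univ a)
  have h0 : 0 ≤ ∑ i, A a i ^ 2 := Finset.sum_nonneg fun _ _ => sq_nonneg _
  rcases h0.eq_or_lt with h | h
  · rw [← h]; positivity
  · rw [sq] at h2
    exact le_of_mul_le_mul_right h2 h

lemma isUnit_det_transpose_mul_self {X : Matrix (Fin n) (Fin d) ℝ} (hX : X.rank = d) :
    IsUnit (Xᵀ * X).det := by
  rw [← Matrix.isUnit_iff_isUnit_det, ← Matrix.mulVec_injective_iff_isUnit]
  have h : (Xᵀ * X).rank = d := by rw [Matrix.rank_transpose_mul_self, hX]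
  have h2 : (Xᵀ * X).mulVecLin.range = ⊤ := by
    apply Submodule.eq_top_of_finrank_eq
    rw [← Matrix.rank, h]
    simp
  exact LinearMap.ker_eq_bot.1 (LinearMap.ker_eq_bot_iff_range_eq_top.2 h2)

lemma leftInverse_mul {X : Matrix (Fin n) (Fin d) ℝ} (hX : X.rank = d) :
    (Xᵀ * X)⁻¹ * Xᵀ * X = 1 := by
  rw [Matrix.mul_assoc, Matrix.nonsing_inv_mul _ (isUnit_det_transpose_mul_self hX)]

lemma transpose_mulVec_residual {X : Matrix (Fin n) (Fin d) ℝ} (hX : X.rank = d)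
    (u : Fin n → ℝ) : Xᵀ *ᵥ (u - X *ᵥ (((Xᵀ * X)⁻¹ * Xᵀ) *ᵥ u)) = 0 := by
  rw [Matrix.mulVec_sub, Matrix.mulVec_mulVec, Matrix.mulVec_mulVec, ← Matrix.mul_assoc,
    Matrix.mul_nonsing_inv _ (isUnit_det_transpose_mul_self hX),
    Matrix.one_mul, sub_self]

/-- The least squares residual is orthogonal to the range of `X`, so by Pythagoras any competitor
loses `‖Xη‖²`, and `X` is injective. -/
lemma eq_of_sum_sq_residual_le {X : Matrix (Fin n) (Fin d) ℝ} (hX : X.rank = d)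
    {u : Fin n → ℝ} {θ : Fin d → ℝ}
    (h : ∑ i, (u i - (X *ᵥ θ) i) ^ 2 ≤
      ∑ i, (u i - (X *ᵥ (((Xᵀ * X)⁻¹ * Xᵀ) *ᵥ u)) i) ^ 2) :
    θ = ((Xᵀ * X)⁻¹ * Xᵀ) *ᵥ u := by
  set θ₀ := ((Xᵀ * X)⁻¹ * Xᵀ) *ᵥ u with hθ₀
  set η := θ - θ₀ with hη
  have hr : (u - X *ᵥ θ₀) ⬝ᵥ (X *ᵥ η) = 0 := by
    rw [Matrix.dotProduct_mulVec, ← Matrix.mulVec_transpose, transpose_mulVec_residual hX,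
      zero_dotProduct]
  have hexp : ∑ i, (u i - (X *ᵥ θ) i) ^ 2 =
      ∑ i, (u i - (X *ᵥ θ₀) i) ^ 2 - 2 * ((u - X *ᵥ θ₀) ⬝ᵥ (X *ᵥ η)) +
        ∑ i, (X *ᵥ η) i ^ 2 := by
    rw [dotProduct, Finset.mul_sum, ← Finset.sum_sub_distrib, ← Finset.sum_add_distrib]
    refine Finset.sum_congr rfl fun i _ => ?_
    rw [hη, Matrix.mulVec_sub]
    simp only [Pi.sub_apply]
    ring
  have hz : ∑ i, (X *ᵥ η) i ^ 2 = 0 :=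
    le_antisymm (by linarith) (Finset.sum_nonneg fun _ _ => sq_nonneg _)
  have hX0 : X *ᵥ η = 0 := by
    ext i
    have := (Finset.sum_eq_zero_iff_of_nonneg fun _ _ => sq_nonneg _).1 hz i (Finset.mem_univ i)
    simpa using this
  have hη0 : η = 0 := by
    have := congrArg (fun x => ((Xᵀ * X)⁻¹ * Xᵀ) *ᵥ x) hX0
    simpa only [Matrix.mulVec_mulVec, leftInverse_mul hX, Matrix.one_mulVec,
      Matrix.mulVec_zero] using this
  exact sub_eq_zero.1 hη0

variable {m k : ℕ}

lemma instanceLoss_eq (X : Matrix (Fin n) (Fin d) ℝ) (B : Bagging n m k) (z : Fin m → ℝ)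
    (θ : EuclideanSpace ℝ (Fin d)) :
    instanceLoss X B z θ = 1 / n * ∑ i, (z (B.toFun i) - (X *ᵥ θ.ofLp) i) ^ 2 := by
  rw [instanceLoss, B.sum_bag_apply fun l i => (z l - X i ⬝ᵥ θ.ofLp) ^ 2]
  rfl

/-- The minimizer of the instance-level loss is the least squares solution. -/
lemma MinimizesInstanceLoss.ofLp_eq {X : Matrix (Fin n) (Fin d) ℝ} (hX : X.rank = d)
    {est : Bagging n m k × (Fin m → ℝ) → EuclideanSpace ℝ (Fin d)}
    (h : MinimizesInstanceLoss X est) (B : Bagging n m k) (z : Fin m → ℝ) :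
    (est (B, z)).ofLp = ((Xᵀ * X)⁻¹ * Xᵀ) *ᵥ fun i => z (B.toFun i) := by
  -- For `n = 0` the factor `1 / n` is `0` and the loss says nothing, but the rank condition forces
  -- `d = 0`.
  rcases Nat.eq_zero_or_pos n with rfl | hn
  · have hd : d = 0 := by
      have := X.rank_le_height
      omega
    subst hd
    exact Subsingleton.elim _ _
  · refine eq_of_sum_sq_residual_le hX ?_
    have h1 := h (B, z) (Set.mem_univ
      (WithLp.toLp 2 (((Xᵀ * X)⁻¹ * Xᵀ) *ᵥ fun i => z (B.toFun i))))
    simp only [Set.mem_ofPred_eq, instanceLoss_eq] at h1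
    exact le_of_mul_le_mul_left h1 (by positivity)

lemma MinimizesInstanceLoss.norm_sub_sq {X : Matrix (Fin n) (Fin d) ℝ} (hX : X.rank = d)
    {est : Bagging n m k × (Fin m → ℝ) → EuclideanSpace ℝ (Fin d)}
    (h : MinimizesInstanceLoss X est) (θstar : EuclideanSpace ℝ (Fin d))
    (o : Bagging n m k × (Fin m → ℝ)) :
    ‖est o - θstar‖ ^ 2 = ∑ a, (((Xᵀ * X)⁻¹ * Xᵀ) *ᵥ
      fun i => o.2 (o.1.toFun i) - X i ⬝ᵥ θstar.ofLp) a ^ 2 := by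
  have hθ : θstar.ofLp = ((Xᵀ * X)⁻¹ * Xᵀ) *ᵥ (X *ᵥ θstar.ofLp) := by
    rw [Matrix.mulVec_mulVec, leftInverse_mul hX, Matrix.one_mulVec]
  have h1 : (est o - θstar).ofLp = ((Xᵀ * X)⁻¹ * Xᵀ) *ᵥ
      fun i => o.2 (o.1.toFun i) - X i ⬝ᵥ θstar.ofLp := by
    rw [WithLp.ofLp_sub, h.ofLp_eq hX o.1 o.2]
    conv_lhs => rw [hθ]
    rw [← Matrix.mulVec_sub]
    rfl
  rw [EuclideanSpace.real_norm_sq_eq, ← h1]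

end LeastSquares

/-! ### Second moments -/

section SecondMoments

lemma lintegral_ofReal_sq {Ω : Type*} [MeasurableSpace Ω] {μ : Measure Ω} [IsProbabilityMeasure μ]
    {Y : Ω → ℝ} (hY : MemLp Y 2 μ) :
    ∫⁻ ω, ENNReal.ofReal (Y ω ^ 2) ∂μ = ENNReal.ofReal (Var[Y; μ] + (∫ ω, Y ω ∂μ) ^ 2) := by
  rw [← ofReal_integral_eq_lintegral_ofReal hY.integrable_sq (ae_of_all _ fun _ => sq_nonneg _),
    variance_eq_sub hY]
  congr 1
  simp

lemma lintegral_pi_ofReal_sq {ι : Type*} [Fintype ι] {ρ : ι → Measure ℝ}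
    [∀ l, IsProbabilityMeasure (ρ l)] (hρ : ∀ l, MemLp id 2 (ρ l)) (c t : ι → ℝ) :
    ∫⁻ z, ENNReal.ofReal ((∑ l, c l * (z l - t l)) ^ 2) ∂Measure.pi ρ =
      ENNReal.ofReal (∑ l, c l ^ 2 * Var[id; ρ l] +
        (∑ l, c l * ((∫ x, x ∂ρ l) - t l)) ^ 2) := by
  have hmem : ∀ l, MemLp (fun x : ℝ => c l * (x - t l)) 2 (ρ l) := fun l =>
    ((hρ l).sub (memLp_const (t l))).const_mul (c l)
  have hmem' : ∀ l, MemLp (fun z : ι → ℝ => c l * (z l - t l)) 2 (Measure.pi ρ) := fun l =>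
    (hmem l).comp_measurePreserving (measurePreserving_eval ρ l)
  rw [lintegral_ofReal_sq (memLp_finsetSum _ fun l _ => hmem' l)]
  congr 2
  · have h := variance_sum_pi hmem
    have e : (∑ l, fun z : ι → ℝ => c l * (z l - t l)) = fun z => ∑ l, c l * (z l - t l) := by
      ext z; simp
    rw [e] at h
    rw [h]
    refine Finset.sum_congr rfl fun l _ => ?_
    rw [variance_const_mul, variance_sub_const (by fun_prop)]
    rfl
  · congr 1
    rw [integral_finsetSum _ fun l _ => (hmem' l).integrable (by norm_num)]
    refine Finset.sum_congr rfl fun l _ => ?_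
    have h1 := integral_comp_eval (μ := ρ) (i := l) (f := fun x : ℝ => c l * (x - t l))
      (hmem l).aestronglyMeasurable
    have hid : Integrable (fun x : ℝ => x) (ρ l) := (hρ l).integrable (by norm_num)
    rw [h1, integral_const_mul, integral_sub hid (integrable_const _)]
    simp

lemma lintegral_gaussianReal_ofReal_sub_sq (b c : ℝ) (v : ℝ≥0) :
    ∫⁻ x, ENNReal.ofReal ((x - c) ^ 2) ∂gaussianReal b v = ENNReal.ofReal (v + (b - c) ^ 2) := by
  have hid : MemLp (fun x : ℝ => x) 2 (gaussianReal b v) := memLp_id_gaussianReal 2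
  have hsub : MemLp (fun x : ℝ => x - c) 2 (gaussianReal b v) := hid.sub (memLp_const c)
  rw [lintegral_ofReal_sq hsub, integral_sub (hid.integrable (by norm_num))
    (integrable_const _), variance_sub_const (by fun_prop), variance_fun_id_gaussianReal,
    integral_id_gaussianReal]
  simp

/-- With `T = ∑ t` and `G = ∑ g`, the cross term `-2(T + G)T` equals `G²/2 - (G + 2T)²/2`.
Cauchy–Schwarz turns `G²/2` into the extra half of `∑ g²`. -/
lemma sum_sum_sub_sq_div_le {ι : Type*} (s : Finset ι) (t g : ι → ℝ) :
    ∑ i ∈ s, (s.card : ℝ)⁻¹ * ∑ j ∈ s, (t j + g j - t i) ^ 2 ≤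
      ∑ j ∈ s, (2 * t j ^ 2 + 3 / 2 * g j ^ 2 + 2 * g j * t j) := by
  rcases s.eq_empty_or_nonempty with rfl | hs
  · simp
  have hc : (0 : ℝ) < s.card := by exact_mod_cast hs.card_pos
  have hG : (∑ j ∈ s, g j) ^ 2 ≤ s.card * ∑ j ∈ s, g j ^ 2 := sq_sum_le_card_mul_sum_sq
  have h1 : ∑ i ∈ s, ∑ j ∈ s, (t j + g j - t i) ^ 2 =
      s.card * ∑ j ∈ s, (2 * t j ^ 2 + g j ^ 2 + 2 * g j * t j) -
        2 * ((∑ j ∈ s, t j + ∑ j ∈ s, g j) * ∑ i ∈ s, t i) := by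
    have e : ∀ i ∈ s, ∑ j ∈ s, (t j + g j - t i) ^ 2 =
        ∑ j ∈ s, (t j ^ 2 + g j ^ 2 + 2 * g j * t j) -
          2 * (∑ j ∈ s, t j + ∑ j ∈ s, g j) * t i + s.card * t i ^ 2 := by
      intro i _
      rw [← Finset.sum_add_distrib, Finset.mul_sum, Finset.sum_mul, ← Finset.sum_sub_distrib,
        ← nsmul_eq_mul, ← Finset.sum_const, ← Finset.sum_add_distrib]
      exact Finset.sum_congr rfl fun j _ => by ring
    rw [Finset.sum_congr rfl e, Finset.sum_add_distrib, Finset.sum_sub_distrib, Finset.sum_const,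
      nsmul_eq_mul, ← Finset.mul_sum, ← Finset.mul_sum]
    have e2 : ∑ j ∈ s, (2 * t j ^ 2 + g j ^ 2 + 2 * g j * t j) =
        ∑ j ∈ s, (t j ^ 2 + g j ^ 2 + 2 * g j * t j) + ∑ j ∈ s, t j ^ 2 := by
      rw [← Finset.sum_add_distrib]
      exact Finset.sum_congr rfl fun j _ => by ring
    rw [e2]
    ring
  have h2 : ∑ j ∈ s, (2 * t j ^ 2 + 3 / 2 * g j ^ 2 + 2 * g j * t j) =
      ∑ j ∈ s, (2 * t j ^ 2 + g j ^ 2 + 2 * g j * t j) + 1 / 2 * ∑ j ∈ s, g j ^ 2 := by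
    rw [Finset.mul_sum, ← Finset.sum_add_distrib]
    exact Finset.sum_congr rfl fun j _ => by ring
  rw [← Finset.mul_sum, h1, h2, inv_mul_le_iff₀ hc]
  nlinarith [sq_nonneg (∑ j ∈ s, g j + 2 * ∑ j ∈ s, t j)]

end SecondMoments

/-! ### Utility of the estimator -/

section Utility

variable {n m k d : ℕ}

lemma lintegral_mirBagLabels_sub_sq (hk : 1 ≤ k) (v : ℝ≥0) (y : Fin n → ℝ) (B : Bagging n m k)
    (l : Fin m) (c : ℝ) :
    ∫⁻ z, ENNReal.ofReal ((z l - c) ^ 2) ∂mirBagLabels v y B =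
      ENNReal.ofReal (v + (k : ℝ)⁻¹ * ∑ j ∈ B.bag l, (y j - c) ^ 2) := by
  have := isProbabilityMeasure_bagLabelLaw hk v y B
  have hk0 : (0 : ℝ) < k := by exact_mod_cast hk
  rw [mirBagLabels_eq_pi, (measurePreserving_eval (bagLabelLaw v y B) l).lintegral_comp
    (f := fun x => ENNReal.ofReal ((x - c) ^ 2)) (by fun_prop), lintegral_bagLabelLaw]
  simp_rw [lintegral_gaussianReal_ofReal_sub_sq]
  rw [← Finset.mul_sum, ← ENNReal.ofReal_sum_of_nonneg fun _ _ => by positivity,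
    ← ENNReal.ofReal_natCast, ← ENNReal.ofReal_inv_of_pos hk0,
    ← ENNReal.ofReal_mul (by positivity), Finset.sum_add_distrib, Finset.sum_const, B.card_bag,
    nsmul_eq_mul, mul_add, inv_mul_cancel_left₀ hk0.ne']

/-- The bound does not involve `B`, so `γ` can be averaged afterwards although the bagging chosen by
the mechanism depends on `γ`. -/
lemma lintegral_mirBagLabels_le (hk : 1 ≤ k) (v : ℝ≥0) (t γ : Fin n → ℝ) (B : Bagging n m k)
    (A : Matrix (Fin d) (Fin n) ℝ) :
    ∫⁻ z, ENNReal.ofReal (∑ a, (A *ᵥ fun i => z (B.toFun i) - t i) a ^ 2)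
        ∂mirBagLabels v (fun i => t i + γ i) B ≤
      ENNReal.ofReal (opNorm A ^ 2) * ∑ i, ENNReal.ofReal
        (v + (2 * t i ^ 2 + 3 / 2 * γ i ^ 2 + 2 * γ i * t i)) := by
  have hq : ∀ i, 0 ≤ 2 * t i ^ 2 + 3 / 2 * γ i ^ 2 + 2 * γ i * t i := fun i => by
    nlinarith [sq_nonneg (γ i + t i), sq_nonneg (t i), sq_nonneg (γ i)]
  calc _ ≤ ∫⁻ z, ENNReal.ofReal (opNorm A ^ 2) *
          ∑ i, ENNReal.ofReal ((z (B.toFun i) - t i) ^ 2)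
            ∂mirBagLabels v (fun i => t i + γ i) B := by
        refine lintegral_mono fun z => ?_
        rw [← ENNReal.ofReal_sum_of_nonneg fun _ _ => sq_nonneg _,
          ← ENNReal.ofReal_mul (sq_nonneg _)]
        exact ENNReal.ofReal_le_ofReal (sum_sq_mulVec_le _ _)
    _ = ENNReal.ofReal (opNorm A ^ 2) * ∑ i, ENNReal.ofReal (v + (k : ℝ)⁻¹ *
          ∑ j ∈ B.bag (B.toFun i), (t j + γ j - t i) ^ 2) := by
        rw [lintegral_const_mul _ (by fun_prop), lintegral_finsetSum _ fun i _ => by fun_prop]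
        simp_rw [lintegral_mirBagLabels_sub_sq hk]
    _ ≤ _ := by
        refine mul_le_mul_right ?_ _
        rw [← ENNReal.ofReal_sum_of_nonneg fun _ _ => by positivity,
          ← ENNReal.ofReal_sum_of_nonneg fun i _ => add_nonneg v.coe_nonneg (hq i)]
        refine ENNReal.ofReal_le_ofReal ?_
        rw [Finset.sum_add_distrib, Finset.sum_add_distrib]
        refine add_le_add_right ?_ _
        rw [← B.sum_bag_apply fun l i => (k : ℝ)⁻¹ * ∑ j ∈ B.bag l, (t j + γ j - t i) ^ 2,
          ← B.sum_bag]
        refine Finset.sum_le_sum fun l _ => ?_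
        have h := sum_sum_sub_sq_div_le (B.bag l) t γ
        rwa [B.card_bag] at h

/-- A bagging into singletons is a bijection, so relabelling removes `B` and leaves variance plus
squared bias. -/
lemma lintegral_mirBagLabels_of_singletons (v : ℝ≥0) (t γ : Fin n → ℝ) (B : Bagging n m 1)
    (c : Fin n → ℝ) :
    ∫⁻ z, ENNReal.ofReal ((∑ i, c i * (z (B.toFun i) - t i)) ^ 2)
        ∂mirBagLabels v (fun i => t i + γ i) B =
      ENNReal.ofReal (∑ i, c i ^ 2 * v + (∑ i, c i * γ i) ^ 2) := by
  choose f hf using fun l => Finset.card_eq_one.1 (B.card_bag l)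
  have hfB : ∀ i, f (B.toFun i) = i := fun i => by
    have : i ∈ B.bag (B.toFun i) := B.mem_bag.2 rfl
    rw [hf] at this
    exact (Finset.mem_singleton.1 this).symm
  have hBf : ∀ l, B.toFun (f l) = l := fun l => by
    rw [← B.mem_bag, hf]
    exact Finset.mem_singleton_self _
  let e : Fin m ≃ Fin n := ⟨f, B.toFun, hBf, hfB⟩
  have hlaw : bagLabelLaw v (fun i => t i + γ i) B =
      fun l => gaussianReal (t (f l) + γ (f l)) v := by
    ext1 l
    simp [bagLabelLaw, hf]
  have hre : ∀ z : Fin m → ℝ, ∑ i, c i * (z (B.toFun i) - t i) =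
      ∑ l, c (f l) * (z l - t (f l)) := fun z => by
    rw [← Equiv.sum_comp e]
    refine Finset.sum_congr rfl fun l _ => ?_
    change c (f l) * (z (B.toFun (f l)) - t (f l)) = _
    rw [hBf]
  rw [mirBagLabels_eq_pi, hlaw]
  simp_rw [hre]
  rw [lintegral_pi_ofReal_sq (fun l => memLp_id_gaussianReal 2) (fun l => c (f l))
    (fun l => t (f l))]
  simp only [variance_id_gaussianReal, integral_id_gaussianReal, add_sub_cancel_left]
  rw [← Equiv.sum_comp e fun i => c i ^ 2 * (v : ℝ), ← Equiv.sum_comp e fun i => c i * γ i]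
  rfl

lemma lintegral_quadratic {ν : Measure ℝ} [IsProbabilityMeasure ν] (h2 : MemLp id 2 ν)
    {σ : ℝ} (hmean : ∫ x, x ∂ν = 0) (hvar : ∫ x, x ^ 2 ∂ν = σ ^ 2) (v : ℝ≥0) (t : ℝ) :
    ∫⁻ x, ENNReal.ofReal (v + (2 * t ^ 2 + 3 / 2 * x ^ 2 + 2 * x * t)) ∂ν =
      ENNReal.ofReal (v + (2 * t ^ 2 + 3 / 2 * σ ^ 2)) := by
  have h1 : Integrable (fun x : ℝ => x) ν := h2.integrable (by norm_num)
  have hsq : Integrable (fun x : ℝ => x ^ 2) ν := h2.integrable_sq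
  have hi : Integrable (fun x : ℝ => 2 * t ^ 2 + 3 / 2 * x ^ 2) ν :=
    (integrable_const _).add (hsq.const_mul _)
  have hj : Integrable (fun x : ℝ => 2 * x * t) ν := (h1.const_mul 2).mul_const t
  have hij : Integrable (fun x : ℝ => 2 * t ^ 2 + 3 / 2 * x ^ 2 + 2 * x * t) ν := hi.add hj
  have hv : Integrable (fun x : ℝ => v + (2 * t ^ 2 + 3 / 2 * x ^ 2 + 2 * x * t)) ν :=
    (integrable_const _).add hij
  rw [← ofReal_integral_eq_lintegral_ofReal hv
    (ae_of_all _ fun x => by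
      have : 0 ≤ 2 * t ^ 2 + 3 / 2 * x ^ 2 + 2 * x * t := by
        nlinarith [sq_nonneg (x + t), sq_nonneg t, sq_nonneg x]
      exact add_nonneg v.coe_nonneg this)]
  congr 1
  rw [integral_add (integrable_const _) hij, integral_add hi hj,
    integral_add (integrable_const _) (hsq.const_mul _), integral_const_mul (3 / 2 : ℝ), hvar,
    integral_mul_const t fun x : ℝ => 2 * x, integral_const_mul (2 : ℝ) fun x : ℝ => x, hmean]
  simp

variable {ν : Fin n → Measure ℝ} {σ : ℝ}

lemma error_le_of_two_le (hk : 1 ≤ k) {C : (Fin n → ℝ) → Bagging n m k} (hC : Measurable C)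
    (s v : ℝ≥0) (t : Fin n → ℝ) (A : Matrix (Fin d) (Fin n) ℝ)
    (hν : ∀ i, IsProbabilityMeasure (ν i)) (hν2 : ∀ i, MemLp id 2 (ν i))
    (hmean : ∀ i, ∫ x, x ∂ν i = 0) (hvar : ∀ i, ∫ x, x ^ 2 ∂ν i = σ ^ 2) :
    ∫⁻ γ, ∫⁻ o, ENNReal.ofReal (∑ a, (A *ᵥ fun i => o.2 (o.1.toFun i) - t i) a ^ 2)
        ∂privateMIR C s v (fun i => t i + γ i) ∂Measure.pi ν ≤
      ENNReal.ofReal (opNorm A ^ 2 * ∑ i, (v + (2 * t i ^ 2 + 3 / 2 * σ ^ 2))) := by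
  have hf : Measurable fun o : Bagging n m k × (Fin m → ℝ) =>
      ENNReal.ofReal (∑ a, (A *ᵥ fun i => o.2 (o.1.toFun i) - t i) a ^ 2) := by
    refine measurable_from_prod_countable_right fun B => ?_
    simp only [Matrix.mulVec, dotProduct]
    fun_prop
  calc _ ≤ ∫⁻ γ, ENNReal.ofReal (opNorm A ^ 2) * ∑ i, ENNReal.ofReal
        (v + (2 * t i ^ 2 + 3 / 2 * γ i ^ 2 + 2 * γ i * t i)) ∂Measure.pi ν := by
        refine lintegral_mono fun γ => ?_
        have : IsProbabilityMeasure (noisyLabels s fun i => t i + γ i) := by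
          unfold noisyLabels
          infer_instance
        rw [lintegral_privateMIR hC s v _ hf]
        refine (lintegral_mono fun w => lintegral_mirBagLabels_le hk v t γ (C w) A).trans ?_
        simp
    _ = ENNReal.ofReal (opNorm A ^ 2) * ∑ i, ENNReal.ofReal
        (v + (2 * t i ^ 2 + 3 / 2 * σ ^ 2)) := by
        rw [lintegral_const_mul _ (by fun_prop), lintegral_finsetSum _ fun i _ => by fun_prop]
        congr 1
        refine Finset.sum_congr rfl fun i _ => ?_
        rw [← lintegral_quadratic (hν2 i) (hmean i) (hvar i) v (t i),
          ← (measurePreserving_eval ν i).lintegral_comp (by fun_prop)]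
    _ = _ := by
        rw [← ENNReal.ofReal_sum_of_nonneg fun _ _ => by positivity,
          ← ENNReal.ofReal_mul (sq_nonneg _)]

lemma error_le_of_singletons {C : (Fin n → ℝ) → Bagging n m 1} (hC : Measurable C)
    (s v : ℝ≥0) (t : Fin n → ℝ) (A : Matrix (Fin d) (Fin n) ℝ)
    (hν : ∀ i, IsProbabilityMeasure (ν i)) (hν2 : ∀ i, MemLp id 2 (ν i))
    (hmean : ∀ i, ∫ x, x ∂ν i = 0) (hvar : ∀ i, ∫ x, x ^ 2 ∂ν i = σ ^ 2) :
    ∫⁻ γ, ∫⁻ o, ENNReal.ofReal (∑ a, (A *ᵥ fun i => o.2 (o.1.toFun i) - t i) a ^ 2)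
        ∂privateMIR C s v (fun i => t i + γ i) ∂Measure.pi ν ≤
      ENNReal.ofReal (opNorm A ^ 2 * (d * (σ ^ 2 + v))) := by
  have hf : Measurable fun o : Bagging n m 1 × (Fin m → ℝ) =>
      ENNReal.ofReal (∑ a, (A *ᵥ fun i => o.2 (o.1.toFun i) - t i) a ^ 2) := by
    refine measurable_from_prod_countable_right fun B => ?_
    simp only [Matrix.mulVec, dotProduct]
    fun_prop
  have hVar : ∀ i, Var[id; ν i] = σ ^ 2 := fun i => by
    rw [variance_eq_sub (hν2 i)]
    simp [hmean i, hvar i]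
  calc _ = ∫⁻ γ, ∑ a, (ENNReal.ofReal (∑ i, A a i ^ 2 * v) +
          ENNReal.ofReal ((∑ i, A a i * (γ i - 0)) ^ 2)) ∂Measure.pi ν := by
        refine lintegral_congr fun γ => ?_
        have : IsProbabilityMeasure (noisyLabels s fun i => t i + γ i) := by
          unfold noisyLabels
          infer_instance
        rw [lintegral_privateMIR hC s v _ hf]
        have hB : ∀ B : Bagging n m 1, ∫⁻ z, ENNReal.ofReal
            (∑ a, (A *ᵥ fun i => z (B.toFun i) - t i) a ^ 2)
              ∂mirBagLabels v (fun i => t i + γ i) B =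
            ∑ a, (ENNReal.ofReal (∑ i, A a i ^ 2 * v) +
              ENNReal.ofReal ((∑ i, A a i * (γ i - 0)) ^ 2)) := fun B => by
          simp_rw [ENNReal.ofReal_sum_of_nonneg fun _ _ => sq_nonneg _]
          rw [lintegral_finsetSum _ fun a _ => by
            simp only [Matrix.mulVec, dotProduct]
            fun_prop]
          refine Finset.sum_congr rfl fun a _ => ?_
          rw [← ENNReal.ofReal_add (by positivity) (sq_nonneg _)]
          simp only [sub_zero]
          exact lintegral_mirBagLabels_of_singletons v t γ B (A a)
        simp_rw [hB]
        simp
    _ = ∑ a, ENNReal.ofReal ((∑ i, A a i ^ 2) * (σ ^ 2 + v)) := by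
        rw [lintegral_finsetSum _ fun a _ => by fun_prop]
        refine Finset.sum_congr rfl fun a _ => ?_
        rw [lintegral_add_left measurable_const, lintegral_pi_ofReal_sq hν2 (A a) fun _ => 0]
        simp only [hVar, hmean, sub_zero, mul_zero, Finset.sum_const_zero, lintegral_const,
          measure_univ, mul_one]
        rw [← ENNReal.ofReal_add (by positivity) (by positivity), ← Finset.sum_mul,
          ← Finset.sum_mul]
        congr 1
        ring
    _ ≤ _ := by
        rw [← ENNReal.ofReal_sum_of_nonneg fun _ _ => by positivity, ← Finset.sum_mul]
        refine ENNReal.ofReal_le_ofReal ?_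
        rw [← mul_assoc, mul_comm _ (d : ℝ)]
        refine mul_le_mul_of_nonneg_right ?_ (by positivity)
        refine (Finset.sum_le_sum fun a _ => sum_sq_row_le A a).trans_eq ?_
        simp

end Utility

/-! ### The choice of noise and the final bound -/

theorem theorem4 (n m k d : ℕ) (hk : 1 ≤ k) (hn : n = m * k)
    (X : Matrix (Fin n) (Fin d) ℝ) (hX : X.rank = d)
    (R ε δ : ℝ) (hR : 0 < R) (hε : 0 < ε) (hε2 : ε ≤ 2) (hδ : 0 < δ) (hδ1 : δ < 1) :
    ∃ (C : (Fin n → ℝ) → Bagging n m k) (v : ℝ≥0),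
      IsOptimalClustering C ∧
      LabelDP R ε δ (privateMIR C (alphaSq R ε δ).toNNReal v) ∧
      ∀ (θstar : EuclideanSpace ℝ (Fin d)) (σ : ℝ) (ν : Fin n → Measure ℝ),
        (∀ i, IsProbabilityMeasure (ν i)) →
        (∀ i, MemLp id 2 (ν i)) →
        (∀ i, ∫ x, x ∂ν i = 0) →
        (∀ i, ∫ x, x ^ 2 ∂ν i = σ ^ 2) →
        (∀ i, (X i ⬝ᵥ θstar.ofLp) ^ 2 + σ ^ 2 ≤ R ^ 2) →
        ∀ est : Bagging n m k × (Fin m → ℝ) → EuclideanSpace ℝ (Fin d),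
          MinimizesInstanceLoss X est →
          ∫⁻ γ, ∫⁻ o, ENNReal.ofReal (‖est o - θstar‖ ^ 2)
              ∂(privateMIR C (alphaSq R ε δ).toNNReal v fun i => X i ⬝ᵥ θstar.ofLp + γ i)
              ∂(Measure.pi ν) ≤
            ENNReal.ofReal (opNorm ((Xᵀ * X)⁻¹ * Xᵀ) ^ 2 *
              (2 * (kMeansOpt m k (fun i => X i ⬝ᵥ θstar.ofLp)
                  + n * (1 - 1 / (k : ℝ)) * alphaSq R ε δ)
                + d * (σ ^ 2 + alphaSq R ε δ / (k : ℝ) ^ 2))) := by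
  have ha := alphaSq_ge (R := R) hε hε2 hδ hδ1
  have hM := sensitivity_le hR hε hε2 hδ hδ1
  have hfail := failure_probability_le hR hε hε2 hδ hδ1
  set a := alphaSq R ε δ
  have hR2 : 0 < R ^ 2 := by positivity
  have ha0 : 0 < a := by nlinarith
  have hv0 : 0 < a - 2 * R ^ 2 := by nlinarith
  have hs : (a.toNNReal : ℝ) = a := Real.coe_toNNReal _ ha0.le
  have hv : ((a - 2 * R ^ 2).toNNReal : ℝ) = a - 2 * R ^ 2 := Real.coe_toNNReal _ hv0.le
  obtain ⟨C, hC⟩ := exists_isOptimalClustering hn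
  -- The saving `2R²` absorbs the term `2t² + 3/2 σ² ≤ 2R²` of each sample; it leaves a positive
  -- variance because `a ≥ 7/2 R²`.
  refine ⟨C, (a - 2 * R ^ 2).toNNReal, hC, ?_, ?_⟩
  · refine labelDP_privateMIR hk hC.1 (by simpa using ha0) (by simpa using hv0) hε ?_ ?_
    · rw [hs, hv]
      exact hM
    · rw [hs, hv]
      exact hfail
  intro θstar σ ν hν hν2 hmean hvar hbound est hest
  have hopt := kMeansOpt_nonneg m k fun i => X i ⬝ᵥ θstar.ofLp
  simp_rw [hest.norm_sub_sq hX θstar]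
  rcases hk.eq_or_lt with rfl | hk2
  · refine (error_le_of_singletons hC.1 _ _ _ _ hν hν2 hmean hvar).trans
      (ENNReal.ofReal_le_ofReal (mul_le_mul_of_nonneg_left ?_ (sq_nonneg _)))
    rw [hv]
    have : (d : ℝ) * (σ ^ 2 + (a - 2 * R ^ 2)) ≤ d * (σ ^ 2 + a) :=
      mul_le_mul_of_nonneg_left (by linarith) (by positivity)
    simp only [Nat.cast_one, div_one, sub_self, mul_zero, zero_mul, one_pow, add_zero]
    linarith
  · refine (error_le_of_two_le hk hC.1 _ _ _ _ hν hν2 hmean hvar).trans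
      (ENNReal.ofReal_le_ofReal (mul_le_mul_of_nonneg_left ?_ (sq_nonneg _)))
    rw [hv]
    have hkinv : 1 / (k : ℝ) ≤ 1 / 2 :=
      one_div_le_one_div_of_le (by norm_num) (by exact_mod_cast hk2)
    have hsum : ∑ i, (a - 2 * R ^ 2 + (2 * (X i ⬝ᵥ θstar.ofLp) ^ 2 + 3 / 2 * σ ^ 2)) ≤ n * a := by
      refine (Finset.sum_le_card_nsmul _ _ a fun i _ => ?_).trans_eq (by simp)
      nlinarith [hbound i, sq_nonneg σ]
    -- Since `1 - 1/k ≥ 1/2`, this term alone suffices; the optimum and the `d` term are only used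
    -- as nonnegative.
    have hna : n * a ≤ 2 * (n * (1 - 1 / (k : ℝ)) * a) := by
      have : 0 ≤ n * a := by positivity
      nlinarith
    have hd : 0 ≤ d * (σ ^ 2 + a / (k : ℝ) ^ 2) := by positivity
    linarith
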